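/- All graphs are finite and simple. A partially labeled graph is a graph in which some vertices carry distinct natural numbers as labels; let $\mathcal{F}$ be the set of partially labeled graphs up to label-preserving isomorphism. The product $H_1\cdot H_2$ is obtained from the disjoint union by identifying vertices with the same label (keeping one copy of multiple edges); it makes $\mathcal{F}$ a commutative monoid whose unit is the graph $\emptyset$ with no vertices. Let $\mathcal{F}_\emptyset\subseteq\mathcal{F}$ be the submonoid of graphs without labels (where the product is disjoint union), let $\mathbb{R}[\mathcal{F}_\emptyset]\subseteq\mathbb{R}[\mathcal{F}]$ be the corresponding monoid algebras, let $\mathcal{K}$ be the ideal of $\mathbb{R}[\mathcal{F}]$ generated by the elements $F-\emptyset$, where $F$ is a (possibly labeled) one-vertex graph, and let $$\mathcal{A}_\emptyset := \mathbb{R}[\mathcal{F}_\emptyset]/(\mathcal{K}\cap\mathbb{R}[\mathcal{F}_\emptyset]).$$ For a graph $H$ and a graph $G$ with at least one vertex, let $t(H;G)$ be the probability that a uniformly random map $V(H)\to V(G)$ sends every edge of $H$ to an edge of $G$. The map $t(\cdot\,;G)$ extends linearly to $\mathbb{R}[\mathcal{F}_\emptyset]$ and induces an algebra homomorphism $t(\cdot\,;G):\mathcal{A}_\emptyset\to\mathbb{R}$.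 An element $f\in\mathcal{A}_\emptyset$ is called positive if $t(f;G)\ge 0$ for every graph $G$ with at least one vertex. **Lemma.** If $x\in\mathcal{A}_\emptyset$ satisfies $gx=h$ for some positive $g,h\in\mathcal{A}_\emptyset$ with $g\neq 0$, then $x$ is positive. -/

import Mathlib

/-- A finite simple partially labeled graph: `labels` is the (finite) set of labels that occur,
`Unlabeled` is the finite type of unlabeled vertices, and the vertex carrying the label `l` is
the element `Sum.inl l` of the vertex type `labels ⊕ Unlabeled`. -/
structure PartiallyLabeledGraph : Type 1 where
  labels : Finset ℕ
  Unlabeled : Type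
  finite_unlabeled : Finite Unlabeled
  graph : SimpleGraph (labels ⊕ Unlabeled)

namespace PartiallyLabeledGraph

attribute [instance] finite_unlabeled

/-- The vertices of a partially labeled graph. -/
abbrev Vertex (H : PartiallyLabeledGraph) : Type := H.labels ⊕ H.Unlabeled

/-- The label of a vertex, if it has one. -/
def label (H : PartiallyLabeledGraph) : H.Vertex → Option ℕ :=
  Sum.elim (fun l => some l.1) (fun _ => none)

/-- Label-preserving isomorphism. -/
def IsIso (H K : PartiallyLabeledGraph) : Prop :=
  ∃ f : H.graph ≃g K.graph, ∀ v, K.label (f v) = H.label v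

theorem IsIso.refl (H : PartiallyLabeledGraph) : IsIso H H :=
  ⟨SimpleGraph.Iso.refl, fun _ => rfl⟩

theorem IsIso.symm {H K : PartiallyLabeledGraph} (h : IsIso H K) : IsIso K H := by
  obtain ⟨f, hf⟩ := h
  refine ⟨f.symm, fun v => ?_⟩
  have := hf (f.symm v)
  rw [RelIso.apply_symm_apply] at this
  exact this.symm

theorem IsIso.trans {H K M : PartiallyLabeledGraph} (h : IsIso H K) (h' : IsIso K M) :
    IsIso H M := by
  obtain ⟨f, hf⟩ := h
  obtain ⟨f', hf'⟩ := h'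
  exact ⟨f.trans f', fun v => (hf' (f v)).trans (hf v)⟩

instance setoid : Setoid PartiallyLabeledGraph :=
  ⟨IsIso, IsIso.refl, IsIso.symm, IsIso.trans⟩

/-- The inclusion of the vertices of `H` into those of the product of `H` and `K`. -/
def mulLeft (H K : PartiallyLabeledGraph) :
    H.Vertex → ↥(H.labels ∪ K.labels) ⊕ (H.Unlabeled ⊕ K.Unlabeled) :=
  Sum.map (fun l => ⟨l.1, Finset.mem_union_left _ l.2⟩) Sum.inl

/-- The inclusion of the vertices of `K` into those of the product of `H` and `K`. -/
def mulRight (H K : PartiallyLabeledGraph) :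
    K.Vertex → ↥(H.labels ∪ K.labels) ⊕ (H.Unlabeled ⊕ K.Unlabeled) :=
  Sum.map (fun l => ⟨l.1, Finset.mem_union_right _ l.2⟩) Sum.inr

/-- The gluing product: the disjoint union in which vertices with the same label are identified
and multiple edges are merged. -/
abbrev mul (H K : PartiallyLabeledGraph) : PartiallyLabeledGraph where
  labels := H.labels ∪ K.labels
  Unlabeled := H.Unlabeled ⊕ K.Unlabeled
  finite_unlabeled := inferInstance
  graph := H.graph.map (mulLeft H K) ⊔ K.graph.map (mulRight H K)

/-- The graph with no vertices. -/
abbrev empty : PartiallyLabeledGraph where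
  labels := ∅
  Unlabeled := Empty
  finite_unlabeled := inferInstance
  graph := ⊥

/-! Auxiliary description: the graph seen on the fixed vertex type `ℕ ⊕ Unlabeled`. -/

/-- The adjacency of `H`, transported to `ℕ ⊕ H.Unlabeled`. -/
def AmbAdj (H : PartiallyLabeledGraph) (x y : ℕ ⊕ H.Unlabeled) : Prop :=
  ∃ v w, H.graph.Adj v w ∧ Sum.map Subtype.val id v = x ∧ Sum.map Subtype.val id w = y

theorem code_injective (H : PartiallyLabeledGraph) :
    Function.Injective (Sum.map Subtype.val id : H.Vertex → ℕ ⊕ H.Unlabeled) :=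
  Sum.map_injective.2 ⟨Subtype.val_injective, Function.injective_id⟩

theorem ambAdj_code (H : PartiallyLabeledGraph) (v w : H.Vertex) :
    H.AmbAdj (Sum.map Subtype.val id v) (Sum.map Subtype.val id w) ↔ H.graph.Adj v w := by
  constructor
  · rintro ⟨v', w', h, hv, hw⟩
    rwa [← H.code_injective hv, ← H.code_injective hw]
  · exact fun h => ⟨v, w, h, rfl, rfl⟩

theorem isIso_of_amb {H K : PartiallyLabeledGraph} (hl : H.labels = K.labels)
    (e : H.Unlabeled ≃ K.Unlabeled)
    (h : ∀ x y, H.AmbAdj x y ↔ K.AmbAdj (Sum.map id e x) (Sum.map id e y)) : IsIso H K := by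
  have hl' : ∀ l, l ∈ H.labels ↔ l ∈ K.labels := fun l => by rw [hl]
  let e' : H.Vertex ≃ K.Vertex := Equiv.sumCongr (Equiv.subtypeEquivRight hl') e
  have hc : ∀ v : H.Vertex, (Sum.map Subtype.val id (e' v) : ℕ ⊕ K.Unlabeled)
      = Sum.map id e (Sum.map Subtype.val id v) := by
    rintro (l | u) <;> rfl
  refine ⟨⟨e', ?_⟩, ?_⟩
  · intro v w
    rw [← ambAdj_code K, ← ambAdj_code H, hc, hc, h]
  · rintro (l | u) <;> rfl

theorem IsIso.amb {H K : PartiallyLabeledGraph} (h : IsIso H K) : H.labels = K.labels ∧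
    ∃ e : H.Unlabeled ≃ K.Unlabeled,
      ∀ x y, H.AmbAdj x y ↔ K.AmbAdj (Sum.map id e x) (Sum.map id e y) := by
  obtain ⟨f, hf⟩ := h
  have hin : ∀ l, ∃ h, f (Sum.inl l) = Sum.inl ⟨l.1, h⟩ := by
    intro l
    have := hf (Sum.inl l)
    rcases hv : f (Sum.inl l) with l' | u'
    · rw [hv] at this
      have h1 : l'.1 = l.1 := Option.some.inj this
      exact ⟨h1 ▸ l'.2, congrArg Sum.inl (Subtype.ext h1)⟩
    · rw [hv] at this
      exact absurd this (by simp [label])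
  have hun : ∀ u, ∃ u', f (Sum.inr u) = Sum.inr u' := by
    intro u
    have := hf (Sum.inr u)
    rcases hv : f (Sum.inr u) with l' | u'
    · rw [hv] at this
      exact absurd this (by simp [label])
    · exact ⟨u', rfl⟩
  have hsurj : ∀ v', ∃ v, f v = v' := f.surjective
  choose e he using hun
  have hbij : Function.Bijective e := by
    constructor
    · intro a b hab
      have : f (Sum.inr a) = f (Sum.inr b) := by rw [he, he, hab]
      exact Sum.inr_injective (f.injective this)
    · intro u'
      obtain ⟨l | u, hv⟩ := hsurj (Sum.inr u')
      · obtain ⟨_, h⟩ := hin l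
        rw [h] at hv
        cases hv
      · exact ⟨u, Sum.inr_injective ((he u).symm.trans hv)⟩
  have hc : ∀ v : H.Vertex, (Sum.map Subtype.val id (f v) : ℕ ⊕ K.Unlabeled)
      = Sum.map id e (Sum.map Subtype.val id v) := by
    rintro (l | u)
    · obtain ⟨_, h⟩ := hin l
      rw [h]
      rfl
    · rw [he]
      rfl
  have hinj : Function.Injective (Sum.map id e : ℕ ⊕ H.Unlabeled → ℕ ⊕ K.Unlabeled) :=
    Sum.map_injective.2 ⟨Function.injective_id, hbij.1⟩
  refine ⟨?_, Equiv.ofBijective e hbij, ?_⟩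
  · ext l
    constructor
    · intro h
      exact (hin ⟨l, h⟩).1
    · intro h
      obtain ⟨l' | u, hv⟩ := hsurj (Sum.inl ⟨l, h⟩)
      · obtain ⟨_, h'⟩ := hin l'
        rw [h'] at hv
        have : l'.1 = l := congrArg Subtype.val (Sum.inl_injective hv)
        exact this ▸ l'.2
      · rw [he] at hv
        cases hv
  · intro x y
    change _ ↔ K.AmbAdj (Sum.map id e x) (Sum.map id e y)
    constructor
    · rintro ⟨v, w, h, rfl, rfl⟩
      rw [← hc, ← hc, ambAdj_code]
      exact f.map_rel_iff.2 h
    · rintro ⟨v', w', h, hv, hw⟩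
      obtain ⟨v, rfl⟩ := hsurj v'
      obtain ⟨w, rfl⟩ := hsurj w'
      rw [hc] at hv hw
      exact ⟨v, w, f.map_rel_iff.1 h, hinj hv, hinj hw⟩

theorem mulLeft_injective (H K : PartiallyLabeledGraph) : Function.Injective (mulLeft H K) :=
  Sum.map_injective.2
    ⟨fun _ _ h => Subtype.ext (Subtype.mk.inj h), Sum.inl_injective⟩

theorem mulRight_injective (H K : PartiallyLabeledGraph) : Function.Injective (mulRight H K) :=
  Sum.map_injective.2
    ⟨fun _ _ h => Subtype.ext (Subtype.mk.inj h), Sum.inr_injective⟩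

theorem mul_ambAdj (H K : PartiallyLabeledGraph) (x y : ℕ ⊕ (H.Unlabeled ⊕ K.Unlabeled)) :
    (H.mul K).AmbAdj x y ↔
      (∃ a b, H.AmbAdj a b ∧ Sum.map id Sum.inl a = x ∧ Sum.map id Sum.inl b = y) ∨
      (∃ a b, K.AmbAdj a b ∧ Sum.map id Sum.inr a = x ∧ Sum.map id Sum.inr b = y) := by
  have hL : ∀ v : H.Vertex, (Sum.map Subtype.val id (mulLeft H K v) :
      ℕ ⊕ (H.Unlabeled ⊕ K.Unlabeled)) = Sum.map id Sum.inl (Sum.map Subtype.val id v) := by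
    rintro (l | u) <;> rfl
  have hR : ∀ v : K.Vertex, (Sum.map Subtype.val id (mulRight H K v) :
      ℕ ⊕ (H.Unlabeled ⊕ K.Unlabeled)) = Sum.map id Sum.inr (Sum.map Subtype.val id v) := by
    rintro (l | u) <;> rfl
  constructor
  · rintro ⟨v, w, h, rfl, rfl⟩
    rcases h with ⟨_, a, b, h, rfl, rfl⟩ | ⟨_, a, b, h, rfl, rfl⟩
    · exact Or.inl ⟨_, _, ⟨a, b, h, rfl, rfl⟩, (hL a).symm, (hL b).symm⟩
    · exact Or.inr ⟨_, _, ⟨a, b, h, rfl, rfl⟩, (hR a).symm, (hR b).symm⟩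
  · rintro (⟨_, _, ⟨a, b, h, rfl, rfl⟩, rfl, rfl⟩ | ⟨_, _, ⟨a, b, h, rfl, rfl⟩, rfl, rfl⟩)
    · exact ⟨mulLeft H K a, mulLeft H K b,
        Or.inl ⟨fun hab => h.ne (mulLeft_injective H K hab), a, b, h, rfl, rfl⟩, hL a, hL b⟩
    · exact ⟨mulRight H K a, mulRight H K b,
        Or.inr ⟨fun hab => h.ne (mulRight_injective H K hab), a, b, h, rfl, rfl⟩, hR a, hR b⟩

theorem not_empty_ambAdj (x y) : ¬ empty.AmbAdj x y := by
  rintro ⟨_, _, h, _⟩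
  exact h

/-- A version of `isIso_of_amb` that only asks for the two implications between adjacencies. -/
theorem isIso_of_amb' {H K : PartiallyLabeledGraph} (hl : H.labels = K.labels)
    (e : H.Unlabeled ≃ K.Unlabeled)
    (h : ∀ x y, H.AmbAdj x y → K.AmbAdj (Sum.map id e x) (Sum.map id e y))
    (h' : ∀ x y, K.AmbAdj x y → H.AmbAdj (Sum.map id e.symm x) (Sum.map id e.symm y)) :
    IsIso H K := by
  refine isIso_of_amb hl e fun x y => ⟨h x y, fun hk => ?_⟩
  have := h' _ _ hk
  simpa [Sum.map_map] using this

theorem mul_congr_aux {H K H' K' : PartiallyLabeledGraph} (e₁ : H.Unlabeled ≃ H'.Unlabeled)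
    (e₂ : K.Unlabeled ≃ K'.Unlabeled)
    (h₁ : ∀ x y, H.AmbAdj x y ↔ H'.AmbAdj (Sum.map id e₁ x) (Sum.map id e₁ y))
    (h₂ : ∀ x y, K.AmbAdj x y ↔ K'.AmbAdj (Sum.map id e₂ x) (Sum.map id e₂ y))
    (x y) (h : (H.mul K).AmbAdj x y) :
    (H'.mul K').AmbAdj (Sum.map id (Equiv.sumCongr e₁ e₂) x)
      (Sum.map id (Equiv.sumCongr e₁ e₂) y) := by
  rw [mul_ambAdj] at h ⊢
  rcases h with ⟨a, b, h, rfl, rfl⟩ | ⟨a, b, h, rfl, rfl⟩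
  · exact Or.inl ⟨_, _, (h₁ a b).1 h, by rcases a with a | a <;> rfl,
      by rcases b with b | b <;> rfl⟩
  · exact Or.inr ⟨_, _, (h₂ a b).1 h, by rcases a with a | a <;> rfl,
      by rcases b with b | b <;> rfl⟩

theorem mul_congr {H K H' K' : PartiallyLabeledGraph} (h₁ : IsIso H H') (h₂ : IsIso K K') :
    IsIso (H.mul K) (H'.mul K') := by
  obtain ⟨hl₁, e₁, h₁⟩ := h₁.amb
  obtain ⟨hl₂, e₂, h₂⟩ := h₂.amb
  refine isIso_of_amb' (by simp only [hl₁, hl₂]) (Equiv.sumCongr e₁ e₂)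
    (mul_congr_aux e₁ e₂ h₁ h₂) (mul_congr_aux e₁.symm e₂.symm ?_ ?_)
  · intro x y
    rw [h₁]
    simp [Sum.map_map]
  · intro x y
    rw [h₂]
    simp [Sum.map_map]

theorem mul_comm_iso (H K : PartiallyLabeledGraph) : IsIso (H.mul K) (K.mul H) := by
  have key : ∀ (H K : PartiallyLabeledGraph) (x y), (H.mul K).AmbAdj x y →
      (K.mul H).AmbAdj (Sum.map id (Equiv.sumComm _ _) x) (Sum.map id (Equiv.sumComm _ _) y) := by
    intro H K x y h
    rw [mul_ambAdj] at h ⊢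
    rcases h with ⟨a, b, h, rfl, rfl⟩ | ⟨a, b, h, rfl, rfl⟩
    · exact Or.inr ⟨_, _, h, by rcases a with a | a <;> rfl, by rcases b with b | b <;> rfl⟩
    · exact Or.inl ⟨_, _, h, by rcases a with a | a <;> rfl, by rcases b with b | b <;> rfl⟩
  exact isIso_of_amb' (Finset.union_comm _ _) (Equiv.sumComm _ _) (key H K) (key K H)

theorem mul_assoc_iso (H K M : PartiallyLabeledGraph) :
    IsIso ((H.mul K).mul M) (H.mul (K.mul M)) := by
  refine isIso_of_amb' (Finset.union_assoc _ _ _) (Equiv.sumAssoc _ _ _) ?_ ?_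
  · intro x y h
    rw [mul_ambAdj] at h ⊢
    rcases h with ⟨a, b, h, rfl, rfl⟩ | ⟨a, b, h, rfl, rfl⟩
    · rw [mul_ambAdj] at h
      rcases h with ⟨a, b, h, rfl, rfl⟩ | ⟨a, b, h, rfl, rfl⟩
      · exact Or.inl ⟨_, _, h, by rcases a with a | a <;> rfl, by rcases b with b | b <;> rfl⟩
      · exact Or.inr ⟨_, _, (mul_ambAdj _ _ _ _).2 (Or.inl ⟨_, _, h, rfl, rfl⟩),
          by rcases a with a | a <;> rfl, by rcases b with b | b <;> rfl⟩
    · exact Or.inr ⟨_, _, (mul_ambAdj _ _ _ _).2 (Or.inr ⟨_, _, h, rfl, rfl⟩),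
        by rcases a with a | a <;> rfl, by rcases b with b | b <;> rfl⟩
  · intro x y h
    rw [mul_ambAdj] at h ⊢
    rcases h with ⟨a, b, h, rfl, rfl⟩ | ⟨a, b, h, rfl, rfl⟩
    · exact Or.inl ⟨_, _, (mul_ambAdj _ _ _ _).2 (Or.inl ⟨_, _, h, rfl, rfl⟩),
        by rcases a with a | a <;> rfl, by rcases b with b | b <;> rfl⟩
    · rw [mul_ambAdj] at h
      rcases h with ⟨a, b, h, rfl, rfl⟩ | ⟨a, b, h, rfl, rfl⟩
      · exact Or.inl ⟨_, _, (mul_ambAdj _ _ _ _).2 (Or.inr ⟨_, _, h, rfl, rfl⟩),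
          by rcases a with a | a <;> rfl, by rcases b with b | b <;> rfl⟩
      · exact Or.inr ⟨_, _, h, by rcases a with a | a <;> rfl, by rcases b with b | b <;> rfl⟩

theorem empty_mul_iso (H : PartiallyLabeledGraph) : IsIso (empty.mul H) H := by
  refine isIso_of_amb' (Finset.empty_union _) (Equiv.emptySum Empty H.Unlabeled) ?_ ?_
  · intro x y h
    rw [mul_ambAdj] at h
    rcases h with ⟨a, b, h, rfl, rfl⟩ | ⟨a, b, h, rfl, rfl⟩
    · exact absurd h (not_empty_ambAdj _ _)
    · convert h using 1
      · rcases a with a | a <;> rfl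
      · rcases b with b | b <;> rfl
  · intro x y h
    rw [mul_ambAdj]
    exact Or.inr ⟨x, y, h, by rcases x with a | a <;> rfl, by rcases y with b | b <;> rfl⟩

/-- The labeled homomorphism density `t(H; G, φ)`: the probability that a random map from the
vertices of `H` to those of `G`, which sends every vertex labeled `l` to `φ l` and is uniform on
the unlabeled vertices, is a homomorphism. Only the restriction of `φ` to the labels of `H`
matters. -/
noncomputable def labeledDensity {W : Type} (G : SimpleGraph W) (φ : ℕ → W)
    (H : PartiallyLabeledGraph) : ℝ :=
  (Nat.card {ψ : H.Unlabeled → W // ∀ v w, H.graph.Adj v w →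
      G.Adj (Sum.elim (fun l => φ l.1) ψ v) (Sum.elim (fun l => φ l.1) ψ w)} : ℝ) /
    (Nat.card (H.Unlabeled → W) : ℝ)

/-- The homomorphism density `t(H; G)`, for `H` considered without its labels: the probability
that a uniformly random map from the vertices of `H` to those of `G` is a homomorphism. -/
noncomputable def homDensity {W : Type} (G : SimpleGraph W) (H : PartiallyLabeledGraph) : ℝ :=
  (Nat.card (H.graph →g G) : ℝ) / (Nat.card (H.Vertex → W) : ℝ)

theorem hom_iff_amb {W : Type} (G : SimpleGraph W) (φ : ℕ → W) (H : PartiallyLabeledGraph)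
    (ψ : H.Unlabeled → W) :
    (∀ v w, H.graph.Adj v w →
      G.Adj (Sum.elim (fun l => φ l.1) ψ v) (Sum.elim (fun l => φ l.1) ψ w)) ↔
    ∀ x y, H.AmbAdj x y → G.Adj (Sum.elim φ ψ x) (Sum.elim φ ψ y) := by
  have hc : ∀ v : H.Vertex, Sum.elim (fun l => φ l.1) ψ v
      = Sum.elim φ ψ (Sum.map Subtype.val id v) := by
    rintro (l | u) <;> rfl
  constructor
  · rintro h _ _ ⟨v, w, hvw, rfl, rfl⟩
    rw [← hc, ← hc]
    exact h v w hvw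
  · intro h v w hvw
    rw [hc, hc]
    exact h _ _ ((ambAdj_code H v w).2 hvw)

theorem labeledDensity_congr {W : Type} (G : SimpleGraph W) (φ : ℕ → W)
    {H K : PartiallyLabeledGraph} (h : IsIso H K) :
    labeledDensity G φ H = labeledDensity G φ K := by
  obtain ⟨-, e, h⟩ := h.amb
  have hx : ∀ (ψ : H.Unlabeled → W) (x : ℕ ⊕ H.Unlabeled),
      Sum.elim φ (ψ ∘ e.symm) (Sum.map id e x) = Sum.elim φ ψ x := by
    rintro ψ (l | u) <;> simp
  unfold labeledDensity
  congr 2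
  · refine Nat.card_congr (Equiv.subtypeEquiv (Equiv.arrowCongr e (Equiv.refl W)) fun ψ => ?_)
    rw [hom_iff_amb, hom_iff_amb]
    change _ ↔ ∀ x y, K.AmbAdj x y →
      G.Adj (Sum.elim φ (ψ ∘ e.symm) x) (Sum.elim φ (ψ ∘ e.symm) y)
    constructor
    · intro hψ x y hxy
      have hs : ∀ x : ℕ ⊕ K.Unlabeled, Sum.map id e (Sum.map id e.symm x) = x := by
        rintro (l | u) <;> simp
      rw [← hs x, ← hs y, hx, hx]
      exact hψ _ _ ((h _ _).2 (by rwa [hs, hs]))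
    · intro hψ x y hxy
      rw [← hx ψ x, ← hx ψ y]
      exact hψ _ _ ((h _ _).1 hxy)
  · exact Nat.card_congr (Equiv.arrowCongr e (Equiv.refl W))

theorem labeledDensity_mul {W : Type} (G : SimpleGraph W) (φ : ℕ → W)
    (H K : PartiallyLabeledGraph) :
    labeledDensity G φ (H.mul K) = labeledDensity G φ H * labeledDensity G φ K := by
  unfold labeledDensity
  rw [div_mul_div_comm, ← Nat.cast_mul, ← Nat.cast_mul, ← Nat.card_prod, ← Nat.card_prod]
  congr 2
  · refine Nat.card_congr (Equiv.trans (Equiv.subtypeEquiv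
      (q := fun p : (H.Unlabeled → W) × (K.Unlabeled → W) =>
        (∀ v w, H.graph.Adj v w →
          G.Adj (Sum.elim (fun l => φ l.1) p.1 v) (Sum.elim (fun l => φ l.1) p.1 w)) ∧
        (∀ v w, K.graph.Adj v w →
          G.Adj (Sum.elim (fun l => φ l.1) p.2 v) (Sum.elim (fun l => φ l.1) p.2 w)))
      (Equiv.sumArrowEquivProdArrow H.Unlabeled K.Unlabeled W) fun ψ => ?_)
      (Equiv.subtypeProdEquivProd (p := fun ψ : H.Unlabeled → W => ∀ v w, H.graph.Adj v w →
          G.Adj (Sum.elim (fun l => φ l.1) ψ v) (Sum.elim (fun l => φ l.1) ψ w))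
        (q := fun ψ : K.Unlabeled → W => ∀ v w, K.graph.Adj v w →
          G.Adj (Sum.elim (fun l => φ l.1) ψ v) (Sum.elim (fun l => φ l.1) ψ w))))
    rw [hom_iff_amb, hom_iff_amb, hom_iff_amb]
    change _ ↔ (∀ x y, H.AmbAdj x y →
        G.Adj (Sum.elim φ (ψ ∘ Sum.inl) x) (Sum.elim φ (ψ ∘ Sum.inl) y)) ∧
      (∀ x y, K.AmbAdj x y →
        G.Adj (Sum.elim φ (ψ ∘ Sum.inr) x) (Sum.elim φ (ψ ∘ Sum.inr) y))
    have hL : ∀ x, Sum.elim φ (ψ ∘ Sum.inl) x = Sum.elim φ ψ (Sum.map id Sum.inl x) := by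
      rintro (l | u) <;> rfl
    have hR : ∀ x, Sum.elim φ (ψ ∘ Sum.inr) x = Sum.elim φ ψ (Sum.map id Sum.inr x) := by
      rintro (l | u) <;> rfl
    constructor
    · intro h
      refine ⟨fun x y hxy => ?_, fun x y hxy => ?_⟩
      · rw [hL, hL]
        exact h _ _ ((mul_ambAdj _ _ _ _).2 (Or.inl ⟨x, y, hxy, rfl, rfl⟩))
      · rw [hR, hR]
        exact h _ _ ((mul_ambAdj _ _ _ _).2 (Or.inr ⟨x, y, hxy, rfl, rfl⟩))
    · rintro ⟨h₁, h₂⟩ x y hxy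
      rcases (mul_ambAdj _ _ _ _).1 hxy with ⟨a, b, h, rfl, rfl⟩ | ⟨a, b, h, rfl, rfl⟩
      · rw [← hL, ← hL]
        exact h₁ a b h
      · rw [← hR, ← hR]
        exact h₂ a b h
  · exact Nat.card_congr (Equiv.sumArrowEquivProdArrow H.Unlabeled K.Unlabeled W)

/-- A graph without edges has density one. -/
theorem labeledDensity_eq_one {W : Type} [Finite W] (G : SimpleGraph W) (φ : ℕ → W)
    (H : PartiallyLabeledGraph) (hH : ∀ v w, ¬ H.graph.Adj v w) :
    labeledDensity G φ H = 1 := by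
  have : Nonempty W := ⟨φ 0⟩
  unfold labeledDensity
  rw [Nat.card_congr (Equiv.subtypeUnivEquiv fun ψ v w h => absurd h (hH v w))]
  exact div_self (Nat.cast_ne_zero.2 Nat.card_pos.ne')

theorem homDensity_congr {W : Type} (G : SimpleGraph W) {H K : PartiallyLabeledGraph}
    (h : IsIso H K) : homDensity G H = homDensity G K := by
  obtain ⟨f, -⟩ := h
  unfold homDensity
  congr 2
  · exact Nat.card_congr
      ⟨fun g => g.comp f.symm.toHom, fun g => g.comp f.toHom,
        fun g => by ext v; simp, fun g => by ext v; simp⟩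
  · exact Nat.card_congr (Equiv.arrowCongr f.toEquiv (Equiv.refl W))

theorem homDensity_eq_labeledDensity {W : Type} (G : SimpleGraph W) (φ : ℕ → W)
    (H : PartiallyLabeledGraph) (hH : H.labels = ∅) :
    homDensity G H = labeledDensity G φ H := by
  obtain ⟨L, U, _, Γ⟩ := H
  dsimp only at hH
  subst hH
  have : IsEmpty (↥(∅ : Finset ℕ)) := ⟨fun l => Finset.notMem_empty _ l.2⟩
  have hx : ∀ (f : ↥(∅ : Finset ℕ) ⊕ U → W) v,
      Sum.elim (fun l => φ l.1) (fun u => f (Sum.inr u)) v = f v := by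
    rintro f (l | u)
    · exact isEmptyElim l
    · rfl
  unfold homDensity labeledDensity
  congr 2
  · refine Nat.card_congr
      ⟨fun g => ⟨fun u => g (Sum.inr u), fun v w h => ?_⟩,
        fun ψ => ⟨Sum.elim (fun l => φ l.1) ψ.1, fun {v w} h => ψ.2 v w h⟩,
        fun g => ?_, fun ψ => ?_⟩
    · rw [hx, hx]
      exact g.map_rel h
    · ext v
      exact hx g v
    · rfl
  · exact Nat.card_congr (Equiv.arrowCongr (Equiv.emptySum _ U) (Equiv.refl W))

end PartiallyLabeledGraph

/-- The set `𝓕` of partially labeled graphs up to label-preserving isomorphism. -/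
def LabeledGraphClass : Type 1 := Quotient PartiallyLabeledGraph.setoid

namespace LabeledGraphClass

/-- The isomorphism class of a partially labeled graph. -/
def mk (H : PartiallyLabeledGraph) : LabeledGraphClass := Quotient.mk _ H

theorem sound {H K : PartiallyLabeledGraph} (h : H.IsIso K) : mk H = mk K := Quotient.sound h

/-- The commutative monoid `𝓕`, under the gluing product, with the empty graph as unit. -/
instance : CommMonoid LabeledGraphClass where
  mul := Quotient.map₂ PartiallyLabeledGraph.mul
    (fun _ _ h₁ _ _ h₂ => PartiallyLabeledGraph.mul_congr h₁ h₂)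
  one := mk PartiallyLabeledGraph.empty
  mul_assoc := by
    rintro ⟨H⟩ ⟨K⟩ ⟨M⟩
    exact sound (PartiallyLabeledGraph.mul_assoc_iso H K M)
  mul_comm := by
    rintro ⟨H⟩ ⟨K⟩
    exact sound (PartiallyLabeledGraph.mul_comm_iso H K)
  one_mul := by
    rintro ⟨H⟩
    exact sound (PartiallyLabeledGraph.empty_mul_iso H)
  mul_one := by
    rintro ⟨H⟩
    exact (sound (PartiallyLabeledGraph.mul_comm_iso H PartiallyLabeledGraph.empty)).trans
      (sound (PartiallyLabeledGraph.empty_mul_iso H))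

theorem mk_mul (H K : PartiallyLabeledGraph) : mk H * mk K = mk (H.mul K) := rfl

theorem one_def : (1 : LabeledGraphClass) = mk PartiallyLabeledGraph.empty := rfl

/-- The set of labels of an isomorphism class. -/
def labels : LabeledGraphClass → Finset ℕ :=
  Quotient.lift PartiallyLabeledGraph.labels
    (fun _ _ h => (PartiallyLabeledGraph.IsIso.amb h).1)

/-- The submonoid `𝓕_∅` of graphs without labels. -/
def unlabeled : Submonoid LabeledGraphClass where
  carrier := {F | F.labels = ∅}
  one_mem' := rfl
  mul_mem' := by
    rintro ⟨H⟩ ⟨K⟩ (h : H.labels = ∅) (k : K.labels = ∅)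
    change H.labels ∪ K.labels = ∅
    rw [h, k, Finset.empty_union]

/-- The labeled homomorphism density `t(F; G, φ)` on isomorphism classes. -/
noncomputable def labeledDensity {W : Type} [Finite W] (G : SimpleGraph W) (φ : ℕ → W) :
    LabeledGraphClass →* ℝ where
  toFun := Quotient.lift (PartiallyLabeledGraph.labeledDensity G φ)
    (fun _ _ h => PartiallyLabeledGraph.labeledDensity_congr G φ h)
  map_one' := PartiallyLabeledGraph.labeledDensity_eq_one G φ _ (fun _ _ h => h)
  map_mul' := by
    rintro ⟨H⟩ ⟨K⟩
    exact PartiallyLabeledGraph.labeledDensity_mul G φ H K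

/-- The homomorphism density `t(F; G)` on isomorphism classes (ignoring labels). -/
noncomputable def homDensity {W : Type} (G : SimpleGraph W) : LabeledGraphClass → ℝ :=
  Quotient.lift (PartiallyLabeledGraph.homDensity G)
    (fun _ _ h => PartiallyLabeledGraph.homDensity_congr G h)

theorem homDensity_eq_labeledDensity {W : Type} [Finite W] (G : SimpleGraph W) (φ : ℕ → W)
    (F : unlabeled) : homDensity G F = labeledDensity G φ F := by
  obtain ⟨⟨H⟩, hH⟩ := F
  exact PartiallyLabeledGraph.homDensity_eq_labeledDensity G φ H hH

/-- The homomorphism density `F ↦ t(F; G)` as a monoid homomorphism on `𝓕_∅`. -/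
noncomputable def unlabeledDensity {W : Type} [Finite W] [Nonempty W] (G : SimpleGraph W) :
    unlabeled →* ℝ where
  toFun F := homDensity G F
  map_one' := by
    rw [homDensity_eq_labeledDensity G (fun _ => Classical.arbitrary W)]
    exact map_one _
  map_mul' F F' := by
    simp only [homDensity_eq_labeledDensity G (fun _ => Classical.arbitrary W)]
    exact map_mul (labeledDensity G (fun _ => Classical.arbitrary W)) (F : LabeledGraphClass) F'

end LabeledGraphClass

/-- The algebra `ℝ[𝓕]` of labeled quantum graphs. -/
abbrev LabeledQuantumGraph : Type 1 := MonoidAlgebra ℝ LabeledGraphClass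

/-- The algebra `ℝ[𝓕_∅]` of quantum graphs. -/
abbrev QuantumGraph : Type 1 := MonoidAlgebra ℝ LabeledGraphClass.unlabeled

/-- The inclusion of `ℝ[𝓕_∅]` in `ℝ[𝓕]`. -/
noncomputable def QuantumGraph.incl : QuantumGraph →ₐ[ℝ] LabeledQuantumGraph :=
  MonoidAlgebra.mapDomainAlgHom ℝ ℝ LabeledGraphClass.unlabeled.subtype

/-- The ideal `𝓚` of `ℝ[𝓕]` generated by the elements `F - ∅`, where `F` runs over the possibly
labeled graphs with exactly one vertex and `∅`, the graph with no vertices, is the unit. -/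
noncomputable def isolatedIdeal : Ideal LabeledQuantumGraph :=
  Ideal.span {f | ∃ H : PartiallyLabeledGraph, Nat.card H.Vertex = 1 ∧
    f = MonoidAlgebra.of ℝ LabeledGraphClass (LabeledGraphClass.mk H)
      - MonoidAlgebra.of ℝ LabeledGraphClass (LabeledGraphClass.mk PartiallyLabeledGraph.empty)}

/-- The ideal `𝓚 ∩ ℝ[𝓕_∅]` of `ℝ[𝓕_∅]`. -/
noncomputable def isolatedIdealUnlabeled : Ideal QuantumGraph :=
  isolatedIdeal.comap QuantumGraph.incl

/-- The algebra `𝓐_∅ = ℝ[𝓕_∅] / (𝓚 ∩ ℝ[𝓕_∅])`. -/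
abbrev QuantumGraphAlgebra : Type 1 := QuantumGraph ⧸ isolatedIdealUnlabeled

/-- The linear extension `f ↦ t(f; G)` of the homomorphism density to `ℝ[𝓕_∅]`. -/
noncomputable def QuantumGraph.density {W : Type} [Finite W] [Nonempty W] (G : SimpleGraph W) :
    QuantumGraph →ₐ[ℝ] ℝ :=
  MonoidAlgebra.lift ℝ ℝ LabeledGraphClass.unlabeled (LabeledGraphClass.unlabeledDensity G)

theorem labeledDensity_isolatedIdeal {W : Type} [Finite W] (G : SimpleGraph W) (φ : ℕ → W)
    (f : LabeledQuantumGraph) (hf : f ∈ isolatedIdeal) :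
    MonoidAlgebra.lift ℝ ℝ LabeledGraphClass (LabeledGraphClass.labeledDensity G φ) f = 0 := by
  suffices h : isolatedIdeal ≤ RingHom.ker
      (MonoidAlgebra.lift ℝ ℝ LabeledGraphClass (LabeledGraphClass.labeledDensity G φ) :
        LabeledQuantumGraph →ₐ[ℝ] ℝ) from
    RingHom.mem_ker.1 (h hf)
  refine Ideal.span_le.2 ?_
  rintro _ ⟨H, hH, rfl⟩
  have h1 : LabeledGraphClass.labeledDensity G φ (LabeledGraphClass.mk H) = 1 := by
    refine PartiallyLabeledGraph.labeledDensity_eq_one G φ H fun v w h => h.ne ?_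
    have := (Nat.card_eq_one_iff_unique.1 hH).1
    exact Subsingleton.elim v w
  rw [SetLike.mem_coe, RingHom.mem_ker, map_sub, MonoidAlgebra.lift_of, MonoidAlgebra.lift_of,
    h1, ← LabeledGraphClass.one_def, map_one, sub_self]

theorem QuantumGraph.density_eq_zero {W : Type} [Finite W] [Nonempty W] (G : SimpleGraph W)
    (f : QuantumGraph) (hf : f ∈ isolatedIdealUnlabeled) : QuantumGraph.density G f = 0 := by
  have h := labeledDensity_isolatedIdeal G (fun _ => Classical.arbitrary W) _ hf
  have hc : (MonoidAlgebra.lift ℝ ℝ LabeledGraphClass (LabeledGraphClass.labeledDensity G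
      (fun _ => Classical.arbitrary W))).comp QuantumGraph.incl = QuantumGraph.density G := by
    refine MonoidAlgebra.algHom_ext (fun F => ?_) (Subsingleton.elim _ _)
    simp [QuantumGraph.incl, QuantumGraph.density, LabeledGraphClass.unlabeledDensity,
      LabeledGraphClass.homDensity_eq_labeledDensity G (fun _ => Classical.arbitrary W)]
  rw [← hc]
  exact h

/-- The algebra homomorphism `x ↦ t(x; G)` from `𝓐_∅` to `ℝ`. -/
noncomputable def QuantumGraphAlgebra.density {W : Type} [Finite W] [Nonempty W]
    (G : SimpleGraph W) : QuantumGraphAlgebra →ₐ[ℝ] ℝ :=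
  Ideal.Quotient.liftₐ isolatedIdealUnlabeled (QuantumGraph.density G)
    (QuantumGraph.density_eq_zero G)

/-- An element `x` of `𝓐_∅` is positive if `t(x; G) ≥ 0` for every finite simple graph `G`
(with at least one vertex). -/
def QuantumGraphAlgebra.IsPositive (x : QuantumGraphAlgebra) : Prop :=
  ∀ (W : Type) [Finite W] [Nonempty W] (G : SimpleGraph W), 0 ≤ QuantumGraphAlgebra.density G x

/-! Suppose `t(x; G) < 0`. Take the disjoint union of a blow-up of `G` with a graph `K` on a fixed
finite vertex set `V`. As the blow-up grows, the share of `V` among the vertices tends to zero, so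
every density tends to its value at `G` (`tendsto_density_blowUp_sum`). Hence `x` is negative on
these unions from some point on. There `g ≥ 0` and `g * x ≥ 0` force the density of `g` to vanish.
Since there are finitely many `K` on `V`, a single blow-up `B` works for all of them.

It remains to contradict the vanishing of `g` on all `B ⊕g K`. Modulo the ideal, isolated vertices
can be removed, so `g` is represented by a nonzero combination `f` of graphs without isolated
vertices. Let `F₀` be a graph in its support with the most vertices, and let `V` be the vertex set
of `F₀`. The homomorphisms `F → B ⊕g K` are the homomorphisms `F → B ⊕g ⊤` whose image has a trace
on `V` contained in `K`. Inverting this sum over subgraphs isolates the maps with trace exactly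
`F₀`. Such a map hits every vertex of `V`, so by maximality it is a bijection onto `V` and `F ≅ F₀`.
Only the term of `F₀` survives, with a positive count, so its coefficient is zero
(`coeff_eq_zero_of_density_sum_eq_zero`). -/

open Filter Topology

/-- A function on a finite partial order whose sums over all lower sets of elements vanish is
zero. -/
theorem eq_zero_of_sum_le_eq_zero {α : Type*} [PartialOrder α] [Fintype α]
    [DecidableLE α] (S : α → ℝ) (hS : ∀ k, ∑ k' with k' ≤ k, S k' = 0) (k : α) :
    S k = 0 := by
  classical
  induction k using WellFoundedLT.induction with
  | ind k ih =>
    have h := hS k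
    rwa [← Finset.add_sum_erase (Finset.univ.filter (· ≤ k)) S
        (Finset.mem_filter.2 ⟨Finset.mem_univ k, le_rfl⟩),
      Finset.sum_eq_zero, add_zero] at h
    intro k' hk'
    rw [Finset.mem_erase, Finset.mem_filter] at hk'
    exact ih k' (lt_of_le_of_ne hk'.2.2 hk'.1)

namespace SimpleGraph

/-! ### Homomorphisms into a disjoint union, sorted by their trace on the second summand -/

section Trace

variable {X A V : Type*} {F : SimpleGraph X} {B : SimpleGraph A}

/-- The trace on `V` of the image of a homomorphism to the disjoint union of `B` and the
complete graph on `V`. -/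
def homTrace (φ : F →g B ⊕g (⊤ : SimpleGraph V)) : SimpleGraph V :=
  (F.map φ).comap Sum.inr

/-- Homomorphisms to `B ⊕g K` are the homomorphisms to `B ⊕g ⊤` with trace below `K`. -/
def homSumEquiv (F : SimpleGraph X) (B : SimpleGraph A) (K : SimpleGraph V) :
    (F →g B ⊕g K) ≃ {φ : F →g B ⊕g (⊤ : SimpleGraph V) // homTrace φ ≤ K} where
  toFun φ := ⟨(Hom.sum Hom.id (Hom.ofLE le_top)).comp φ, by
    rintro v w ⟨-, x, y, hxy, hx, hy⟩
    have h := φ.map_adj hxy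
    rcases hx' : φ x with a | a <;> rcases hy' : φ y with b | b <;>
      simp_all⟩
  invFun φ := ⟨φ.1, by
    intro x y hxy
    have h := φ.1.map_adj hxy
    have h2 := φ.2
    rcases hx : φ.1 x with a | a <;> rcases hy : φ.1 y with b | b
    · simpa [hx, hy] using h
    · simp [hx, hy] at h
    · simp [hx, hy] at h
    · rw [sum_adj_inr]
      -- An edge of the trace needs distinct endpoints; adjacency in `B ⊕g ⊤` provides this.
      refine h2 ⟨?_, x, y, hxy, hx, hy⟩
      rw [← hx, ← hy]
      exact h.ne⟩
  left_inv φ := by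
    ext x
    rcases hx : φ x with a | a <;> simp [hx]
  right_inv φ := by
    ext x
    rcases hx : φ.1 x with a | a <;> simp [hx]

/-- The summands do not depend on `K`, which enters only through the range `K' ≤ K`. The counts by
exact trace can therefore be recovered by inversion over the order of graphs on `V`. -/
theorem card_hom_sum_eq [Finite X] [Finite A] [Finite V] [Fintype (SimpleGraph V)]
    [DecidableLE (SimpleGraph V)] (F : SimpleGraph X) (B : SimpleGraph A) (K : SimpleGraph V) :
    Nat.card (F →g B ⊕g K) =
      ∑ K' with K' ≤ K, Nat.card {φ : F →g B ⊕g (⊤ : SimpleGraph V) // homTrace φ = K'} := by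
  have : Finite (F →g B ⊕g (⊤ : SimpleGraph V)) := DFunLike.finite _
  have e : {φ : F →g B ⊕g (⊤ : SimpleGraph V) // homTrace φ ≤ K} ≃
      Σ K' : {K' // K' ∈ Finset.univ.filter (· ≤ K)},
        {φ : F →g B ⊕g (⊤ : SimpleGraph V) // homTrace φ = K'} :=
    { toFun := fun φ => ⟨⟨homTrace φ.1, by simpa using φ.2⟩, φ.1, rfl⟩
      invFun := fun s => ⟨s.2.1, by
        have := s.1.2
        rw [Finset.mem_filter] at this
        rw [s.2.2]
        exact this.2⟩
      left_inv := fun φ => rfl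
      right_inv := by
        rintro ⟨⟨K', h⟩, φ, hφ⟩
        dsimp only at hφ
        subst hφ
        rfl }
  rw [Nat.card_congr ((homSumEquiv F B K).trans e), Nat.card_sigma]
  exact Finset.sum_coe_sort (Finset.univ.filter (· ≤ K))
    fun K' => Nat.card {φ : F →g B ⊕g (⊤ : SimpleGraph V) // homTrace φ = K'}

/-- A graph with at most as many vertices as `V` that has a homomorphism with trace `K`, where
`K` has no isolated vertices, is isomorphic to `K`. -/
theorem nonempty_iso_of_homTrace [Finite X] [Finite V]
    (φ : F →g B ⊕g (⊤ : SimpleGraph V)) (hφ : ∀ v, ∃ w, (homTrace φ).Adj v w)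
    (hcard : Nat.card X ≤ Nat.card V) : Nonempty (homTrace φ ≃g F) := by
  -- A vertex with an edge in the trace lies in the image of `φ`. A choice of preimages is
  -- injective, hence bijective by the bound on the number of vertices.
  have hs : ∀ v : V, ∃ x, φ x = Sum.inr v := by
    intro v
    obtain ⟨w, -, x, y, -, hx, -⟩ := hφ v
    exact ⟨x, hx⟩
  choose s hs using hs
  have hinj : Function.Injective s := fun v w h =>
    Sum.inr_injective ((hs v).symm.trans ((congrArg φ h).trans (hs w)))
  have hbij : Function.Bijective s :=
    (Nat.bijective_iff_injective_and_card s).2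
      ⟨hinj, le_antisymm (Nat.card_le_card_of_injective s hinj) hcard⟩
  refine ⟨⟨Equiv.ofBijective s hbij, ?_⟩⟩
  intro v w
  change F.Adj (s v) (s w) ↔ _
  constructor
  · intro h
    refine ⟨fun hvw => h.ne ?_, s v, s w, h, hs v, hs w⟩
    rw [Sum.inr_injective hvw]
  · rintro ⟨-, x, y, hxy, hx, hy⟩
    obtain ⟨a, rfl⟩ := hbij.2 x
    obtain ⟨b, rfl⟩ := hbij.2 y
    rw [hs] at hx hy
    rwa [← Sum.inr_injective hx, ← Sum.inr_injective hy]

end Trace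

/-! ### Densities in a large blow-up with a fixed graph added -/

section BlowUp

variable {X A V W : Type*}

/-- Adjacency in the blow-up ignores the second coordinate, which can thus be chosen freely at each
vertex of `F`. -/
theorem card_hom_comap_fst [Finite X] (F : SimpleGraph X) (G : SimpleGraph W) (Y : Type*) :
    Nat.card (F →g G.comap (Prod.fst : W × Y → W)) =
      Nat.card (F →g G) * Nat.card Y ^ Nat.card X := by
  rw [← Nat.card_fun, ← Nat.card_prod]
  exact Nat.card_congr
    { toFun := fun φ => (⟨fun x => (φ x).1, fun h => φ.map_adj h⟩, fun x => (φ x).2)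
      invFun := fun p => ⟨fun x => (p.1 x, p.2 x), fun h => p.1.map_adj h⟩
      left_inv := fun φ => rfl
      right_inv := fun p => rfl }

/-- Maps that stay in `A` are counted exactly, and homomorphisms that meet `V` are at most as many
as all maps that meet `V`. The second bound is written additively to avoid subtraction in `ℕ`. -/
theorem card_hom_sum_bounds [Finite X] [Finite A] [Finite V] (F : SimpleGraph X)
    (B : SimpleGraph A) (K : SimpleGraph V) :
    Nat.card (F →g B) ≤ Nat.card (F →g B ⊕g K) ∧
      Nat.card (F →g B ⊕g K) + Nat.card A ^ Nat.card X ≤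
        Nat.card (F →g B) + (Nat.card A + Nat.card V) ^ Nat.card X := by
  classical
  have : Finite (F →g B ⊕g K) := DFunLike.finite _
  let p : (X → A ⊕ V) → Prop := fun f => ∀ x, ∃ a, f x = Sum.inl a
  have h1 : Nat.card (F →g B) = Nat.card {φ : F →g B ⊕g K // p φ} := by
    refine Nat.card_congr (Equiv.ofBijective
      (fun ψ => ⟨Embedding.sumInl.toHom.comp ψ, fun x => ⟨ψ x, rfl⟩⟩) ⟨?_, ?_⟩)
    · intro ψ ψ' h
      ext x
      exact Sum.inl_injective (DFunLike.congr_fun (Subtype.ext_iff.1 h) x)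
    · rintro ⟨φ, hφ⟩
      choose f hf using id hφ
      refine ⟨⟨f, fun {x y} h => ?_⟩, ?_⟩
      · have := φ.map_adj h
        rwa [hf, hf, sum_adj_inl] at this
      · apply Subtype.ext
        ext x
        exact (hf x).symm
  have h2 : Nat.card (X → A) = Nat.card {f : X → A ⊕ V // p f} := by
    refine Nat.card_congr (Equiv.ofBijective
      (fun ψ => ⟨fun x => Sum.inl (ψ x), fun x => ⟨ψ x, rfl⟩⟩) ⟨?_, ?_⟩)
    · intro ψ ψ' h
      ext x
      exact Sum.inl_injective (congrFun (Subtype.ext_iff.1 h) x)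
    · rintro ⟨φ, hφ⟩
      choose f hf using id hφ
      exact ⟨f, Subtype.ext (funext fun x => (hf x).symm)⟩
  have h3 : Nat.card (F →g B ⊕g K) =
      Nat.card {φ : F →g B ⊕g K // p φ} + Nat.card {φ : F →g B ⊕g K // ¬ p φ} := by
    rw [← Nat.card_sum]
    exact Nat.card_congr (Equiv.sumCompl fun φ : F →g B ⊕g K => p φ).symm
  have h4 : Nat.card (X → A ⊕ V) =
      Nat.card {f : X → A ⊕ V // p f} + Nat.card {f : X → A ⊕ V // ¬ p f} := by
    rw [← Nat.card_sum]
    exact Nat.card_congr (Equiv.sumCompl p).symm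
  have h5 : Nat.card {φ : F →g B ⊕g K // ¬ p φ} ≤ Nat.card {f : X → A ⊕ V // ¬ p f} :=
    Nat.card_le_card_of_injective (fun φ => ⟨φ.1, φ.2⟩) fun φ ψ h =>
      Subtype.ext (DFunLike.coe_injective (Subtype.ext_iff.1 h))
  rw [Nat.card_fun] at h2 h4
  rw [Nat.card_sum] at h4
  omega

/-- The homomorphism density in the disjoint union of a fixed graph with a growing blow-up of `G`
tends to the homomorphism density in `G`. -/
theorem tendsto_card_hom_blowUp_sum [Finite X] [Finite V] [Finite W] [Nonempty W]
    (F : SimpleGraph X) (G : SimpleGraph W) (K : SimpleGraph V) :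
    Tendsto (fun n : ℕ =>
      (Nat.card (F →g G.comap (Prod.fst : W × Fin (n + 1) → W) ⊕g K) : ℝ) /
        (Nat.card (X → W × Fin (n + 1) ⊕ V) : ℝ)) atTop
      (𝓝 ((Nat.card (F →g G) : ℝ) / (Nat.card (X → W) : ℝ))) := by
  have hw : (0 : ℝ) < Nat.card W := Nat.cast_pos.2 Nat.card_pos
  have hv : (0 : ℝ) ≤ Nat.card V := Nat.cast_nonneg _
  -- The probability that a random map sends all of `X` into the blow-up. The density is squeezed
  -- between `r n * t` and `r n * t + (1 - r n)`, where `t` is the density in `G`. Fibres of size `n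
  -- + 1` keep the blow-up nonempty.
  let r : ℕ → ℝ := fun n =>
    ((Nat.card W * ((n : ℝ) + 1)) / (Nat.card W * ((n : ℝ) + 1) + Nat.card V)) ^ Nat.card X
  have hr : Tendsto r atTop (𝓝 1) := by
    have h0 : Tendsto (fun n : ℕ => (Nat.card V : ℝ) / (Nat.card W * ((n : ℝ) + 1))) atTop
        (𝓝 0) :=
      Tendsto.const_div_atTop (Tendsto.const_mul_atTop hw
        (tendsto_atTop_add_const_right _ _ tendsto_natCast_atTop_atTop)) _
    have h1 := (((h0.const_add 1).inv₀ (by norm_num)).pow (Nat.card X))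
    simp only [add_zero, inv_one, one_pow] at h1
    refine h1.congr fun n => ?_
    have : (0 : ℝ) < Nat.card W * ((n : ℝ) + 1) := by positivity
    simp only [r]
    congr 1
    field_simp
  have ht : Tendsto (fun n => r n * ((Nat.card (F →g G) : ℝ) / (Nat.card (X → W) : ℝ))) atTop
      (𝓝 ((Nat.card (F →g G) : ℝ) / (Nat.card (X → W) : ℝ))) := by
    simpa using hr.mul_const ((Nat.card (F →g G) : ℝ) / (Nat.card (X → W) : ℝ))
  have ht' : Tendsto
      (fun n => r n * ((Nat.card (F →g G) : ℝ) / (Nat.card (X → W) : ℝ)) + (1 - r n)) atTop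
      (𝓝 ((Nat.card (F →g G) : ℝ) / (Nat.card (X → W) : ℝ))) := by
    simpa using ht.add (hr.const_sub 1)
  have key : ∀ n : ℕ, r n * ((Nat.card (F →g G) : ℝ) / (Nat.card (X → W) : ℝ)) =
      (Nat.card (F →g G) * ((n : ℝ) + 1) ^ Nat.card X) /
        (Nat.card W * ((n : ℝ) + 1) + Nat.card V) ^ Nat.card X := by
    intro n
    have : (0 : ℝ) < Nat.card W * ((n : ℝ) + 1) + Nat.card V := by positivity
    simp only [r, Nat.card_fun, Nat.cast_pow, div_pow, mul_pow]
    field_simp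
  have hT : ∀ n : ℕ, (Nat.card (X → W × Fin (n + 1) ⊕ V) : ℝ) =
      (Nat.card W * ((n : ℝ) + 1) + Nat.card V) ^ Nat.card X := by
    intro n
    simp [Nat.card_fun, Nat.card_sum, Nat.card_prod]
  have hTpos : ∀ n : ℕ, (0 : ℝ) < (Nat.card W * ((n : ℝ) + 1) + Nat.card V) ^ Nat.card X :=
    fun n => by positivity
  refine tendsto_of_tendsto_of_tendsto_of_le_of_le ht ht' (fun n => ?_) fun n => ?_
  · have hb := (card_hom_sum_bounds F (G.comap (Prod.fst : W × Fin (n + 1) → W)) K).1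
    rw [card_hom_comap_fst, Nat.card_fin] at hb
    simp only [key, hT]
    refine div_le_div_of_nonneg_right ?_ (hTpos n).le
    exact_mod_cast hb
  · have hb := (card_hom_sum_bounds F (G.comap (Prod.fst : W × Fin (n + 1) → W)) K).2
    rw [card_hom_comap_fst, Nat.card_prod, Nat.card_fin] at hb
    have hb' : (Nat.card (F →g G.comap (Prod.fst : W × Fin (n + 1) → W) ⊕g K) : ℝ) +
        (Nat.card W * ((n : ℝ) + 1)) ^ Nat.card X ≤
        Nat.card (F →g G) * ((n : ℝ) + 1) ^ Nat.card X +
          (Nat.card W * ((n : ℝ) + 1) + Nat.card V) ^ Nat.card X := by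
      exact_mod_cast hb
    simp only [key, hT]
    simp only [r, div_pow]
    rw [div_le_iff₀ (hTpos n), add_mul, sub_mul, div_mul_cancel₀ _ (hTpos n).ne',
      div_mul_cancel₀ _ (hTpos n).ne']
    linarith

end BlowUp

end SimpleGraph

/-! ### Removal of isolated vertices modulo the ideal -/

namespace PartiallyLabeledGraph

/-- The unlabeled graph with one vertex. -/
abbrev point : PartiallyLabeledGraph where
  labels := ∅
  Unlabeled := Unit
  finite_unlabeled := inferInstance
  graph := ⊥

/-- The graph obtained by deleting an unlabeled vertex. -/
abbrev deleteUnlabeled (H : PartiallyLabeledGraph) (u : H.Unlabeled) : PartiallyLabeledGraph where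
  labels := H.labels
  Unlabeled := {u' : H.Unlabeled // u' ≠ u}
  finite_unlabeled := inferInstance
  graph := H.graph.comap (Sum.map id Subtype.val)

theorem isIso_deleteUnlabeled_mul_point (H : PartiallyLabeledGraph) (u : H.Unlabeled)
    (hu : ∀ w, ¬ H.graph.Adj (Sum.inr u) w) : IsIso ((H.deleteUnlabeled u).mul point) H := by
  classical
  let e : {u' : H.Unlabeled // u' ≠ u} ⊕ Unit ≃ H.Unlabeled :=
    (Equiv.optionEquivSumPUnit _).symm.trans (Equiv.optionSubtypeNe u)
  have he : ∀ u', e (Sum.inl u') = u'.1 := fun u' => by simp [e]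
  have he' : ∀ u' (h : u' ≠ u), e.symm u' = Sum.inl ⟨u', h⟩ := fun u' h => by
    rw [Equiv.symm_apply_eq, he]
  refine isIso_of_amb' (Finset.union_empty _) e ?_ ?_
  · intro x y hxy
    rw [mul_ambAdj] at hxy
    have hc : ∀ v : (H.deleteUnlabeled u).Vertex, (Sum.map id e (Sum.map id Sum.inl
        (Sum.map Subtype.val id v : ℕ ⊕ {u' : H.Unlabeled // u' ≠ u})) : ℕ ⊕ H.Unlabeled) =
        Sum.map Subtype.val id (Sum.map id Subtype.val v : H.Vertex) := by
      rintro (l | u') <;> simp [he]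
    rcases hxy with ⟨_, _, ⟨v, w, h, rfl, rfl⟩, rfl, rfl⟩ | ⟨_, _, ⟨v, w, h, -⟩, -⟩
    · rw [hc, hc, ambAdj_code]
      exact h
    · exact absurd h id
  · rintro x y ⟨v, w, h, rfl, rfl⟩
    have hc : ∀ v : H.Vertex, v ≠ Sum.inr u → ∃ v' : (H.deleteUnlabeled u).Vertex,
        Sum.map id Subtype.val v' = v ∧
        (Sum.map id e.symm (Sum.map Subtype.val id v : ℕ ⊕ H.Unlabeled) :
          ℕ ⊕ ({u' : H.Unlabeled // u' ≠ u} ⊕ Unit)) =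
        Sum.map id Sum.inl (Sum.map Subtype.val id v') := by
      rintro (l | u') hv
      · exact ⟨Sum.inl l, rfl, rfl⟩
      · have hv' : u' ≠ u := fun h => hv (h ▸ rfl)
        exact ⟨Sum.inr ⟨u', hv'⟩, rfl, by simp [he' u' hv']⟩
    obtain ⟨v', hv, hv'⟩ := hc v (by rintro rfl; exact hu _ h)
    obtain ⟨w', hw, hw'⟩ := hc w (by rintro rfl; exact hu _ h.symm)
    rw [hv', hw', mul_ambAdj]
    refine Or.inl ⟨_, _, ⟨v', w', ?_, rfl, rfl⟩, rfl, rfl⟩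
    rw [SimpleGraph.comap_adj, hv, hw]
    exact h

theorem isIso_of_labels_eq_empty {H K : PartiallyLabeledGraph} (hH : H.labels = ∅)
    (hK : K.labels = ∅) (f : H.graph ≃g K.graph) : IsIso H K := by
  have hnone : ∀ {M : PartiallyLabeledGraph}, M.labels = ∅ → ∀ v, M.label v = none := by
    rintro M hM (l | u)
    · exact absurd l.2 (Finset.eq_empty_iff_forall_notMem.1 hM _)
    · rfl
  exact ⟨f, fun v => by rw [hnone hH, hnone hK]⟩

theorem card_vertex_congr {H K : PartiallyLabeledGraph} (h : IsIso H K) :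
    Nat.card H.Vertex = Nat.card K.Vertex := by
  obtain ⟨f, -⟩ := h
  exact Nat.card_congr f.toEquiv

end PartiallyLabeledGraph

namespace LabeledGraphClass

/-- A representative of an isomorphism class. -/
noncomputable def rep (F : LabeledGraphClass) : PartiallyLabeledGraph := Quotient.out F

theorem mk_rep (F : LabeledGraphClass) : mk F.rep = F := Quotient.out_eq F

theorem rep_mk_isIso (H : PartiallyLabeledGraph) : (mk H).rep.IsIso H := Quotient.mk_out H

theorem rep_labels (F : unlabeled) : F.1.rep.labels = ∅ := by
  have h : (mk F.1.rep).labels = ∅ := by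
    rw [mk_rep]
    exact F.2
  exact h

theorem homDensity_eq_rep {W : Type} (G : SimpleGraph W) (F : LabeledGraphClass) :
    homDensity G F = PartiallyLabeledGraph.homDensity G F.rep := by
  conv_lhs => rw [← mk_rep F]
  rfl

/-- Every vertex of the graph has a neighbor. -/
def NoIsolated (F : LabeledGraphClass) : Prop := ∀ v, ∃ w, F.rep.graph.Adj v w

/-- An isolated vertex splits off as a factor `point`, which is congruent to the unit. Induction on
the number of vertices removes them all. -/
theorem exists_noIsolated_sub_mem (F : unlabeled) : ∃ F' : unlabeled, F'.1.NoIsolated ∧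
    MonoidAlgebra.of ℝ unlabeled F - MonoidAlgebra.of ℝ unlabeled F' ∈
      isolatedIdealUnlabeled := by
  induction hn : Nat.card F.1.rep.Vertex using Nat.strong_induction_on generalizing F with
  | _ n ih =>
    by_cases hF : F.1.NoIsolated
    · exact ⟨F, hF, by rw [sub_self]; exact zero_mem _⟩
    · unfold NoIsolated at hF
      push Not at hF
      obtain ⟨l | u, hu⟩ := hF
      · exact absurd l.2 (Finset.eq_empty_iff_forall_notMem.1 (rep_labels F) _)
      · let H := F.1.rep.deleteUnlabeled u
        have hprod : mk H * mk PartiallyLabeledGraph.point = F.1 := by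
          rw [mk_mul, sound (F.1.rep.isIso_deleteUnlabeled_mul_point u hu), mk_rep]
        have hlt : Nat.card (mk H).rep.Vertex < n := by
          rw [PartiallyLabeledGraph.card_vertex_congr (rep_mk_isIso H), ← hn]
          have hinj : Function.Injective
              (Sum.map id Subtype.val : H.Vertex → F.1.rep.Vertex) :=
            Sum.map_injective.2 ⟨Function.injective_id, Subtype.val_injective⟩
          refine lt_of_le_of_ne (Nat.card_le_card_of_injective _ hinj) fun h => ?_
          obtain ⟨l | u', h'⟩ :=
            ((Nat.bijective_iff_injective_and_card _).2 ⟨hinj, h⟩).2 (Sum.inr u)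
          · cases h'
          · exact u'.2 (Sum.inr_injective h')
        obtain ⟨F', hF', hmem⟩ := ih _ hlt ⟨mk H, rep_labels F⟩ rfl
        refine ⟨F', hF', ?_⟩
        rw [← sub_add_sub_cancel _ (MonoidAlgebra.of ℝ unlabeled ⟨mk H, rep_labels F⟩)]
        refine add_mem ?_ hmem
        change QuantumGraph.incl _ ∈ isolatedIdeal
        have hincl : ∀ F : unlabeled, QuantumGraph.incl (MonoidAlgebra.of ℝ unlabeled F) =
            MonoidAlgebra.of ℝ LabeledGraphClass F.1 := fun F => by
          simp [QuantumGraph.incl]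
        rw [map_sub, hincl, hincl, ← hprod, map_mul]
        -- With `H` the graph after deletion, `F - H = H * (point - 1)` is a multiple of a generator
        -- of the ideal.
        have hfac : ∀ a b : LabeledQuantumGraph, a * b - a = a * (b - 1) := fun a b => by ring
        rw [hfac]
        refine Ideal.mul_mem_left _ _ (Ideal.subset_span
          ⟨PartiallyLabeledGraph.point, ?_, ?_⟩)
        · simp
        · rw [← one_def, map_one]

end LabeledGraphClass

open LabeledGraphClass

/-! ### Detection of a coefficient from densities -/

namespace QuantumGraph

theorem density_eq_sum {W : Type} [Finite W] [Nonempty W] (G : SimpleGraph W)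
    (f : QuantumGraph) : density G f =
      ∑ F ∈ f.coeff.support, f.coeff F * PartiallyLabeledGraph.homDensity G F.1.rep := by
  rw [density, MonoidAlgebra.lift_apply, Finsupp.sum]
  refine Finset.sum_congr rfl fun F _ => ?_
  rw [smul_eq_mul, ← homDensity_eq_rep]
  rfl

theorem exists_noIsolated_sub_mem (f : QuantumGraph) : ∃ f' : QuantumGraph,
    (∀ F ∈ f'.coeff.support, F.1.NoIsolated) ∧ f - f' ∈ isolatedIdealUnlabeled := by
  choose r hr hmem using LabeledGraphClass.exists_noIsolated_sub_mem
  induction f using MonoidAlgebra.induction_linear with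
  | zero => exact ⟨0, by simp, by simp⟩
  | add f g hf hg =>
    classical
    obtain ⟨f', hf', hf⟩ := hf
    obtain ⟨g', hg', hg⟩ := hg
    refine ⟨f' + g', fun F hF => ?_, ?_⟩
    · rcases Finset.mem_union.1 (Finsupp.support_add hF) with h | h
      exacts [hf' F h, hg' F h]
    · rw [add_sub_add_comm]
      exact add_mem hf hg
  | single F c =>
    refine ⟨MonoidAlgebra.single (r F) c, fun F' hF' => ?_, ?_⟩
    · have := Finsupp.support_single_subset hF'
      rw [Finset.mem_singleton] at this
      exact this ▸ hr F
    · have h := Ideal.mul_mem_left isolatedIdealUnlabeled (algebraMap ℝ QuantumGraph c) (hmem F)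
      rwa [← Algebra.smul_def, smul_sub, MonoidAlgebra.of_apply, MonoidAlgebra.of_apply,
        MonoidAlgebra.smul_single, MonoidAlgebra.smul_single, smul_eq_mul, mul_one] at h

theorem tendsto_density_blowUp_sum {V W : Type} [Finite V] [Finite W] [Nonempty W]
    (G : SimpleGraph W) (K : SimpleGraph V) (f : QuantumGraph) :
    Tendsto (fun n : ℕ => density (G.comap (Prod.fst : W × Fin (n + 1) → W) ⊕g K) f) atTop
      (𝓝 (density G f)) := by
  simp only [density_eq_sum]
  exact tendsto_finsetSum _ fun F _ =>
    (SimpleGraph.tendsto_card_hom_blowUp_sum F.1.rep.graph G K).const_mul _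

/-- A graph without isolated vertices does not occur in `f`, if it has at least as many vertices
as all graphs that occur and `f` vanishes on the disjoint unions of a fixed graph with all graphs
on its vertex set. -/
theorem coeff_eq_zero_of_density_sum_eq_zero {A : Type} [Finite A] [Nonempty A]
    (B : SimpleGraph A) (f : QuantumGraph) (F₀ : unlabeled) (hF₀ : F₀.1.NoIsolated)
    (hmax : ∀ F ∈ f.coeff.support, Nat.card F.1.rep.Vertex ≤ Nat.card F₀.1.rep.Vertex)
    (hf : ∀ K : SimpleGraph F₀.1.rep.Vertex, density (B ⊕g K) f = 0) : f.coeff F₀ = 0 := by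
  classical
  have : Fintype (SimpleGraph F₀.1.rep.Vertex) := Fintype.ofFinite _
  let N : LabeledGraphClass → SimpleGraph F₀.1.rep.Vertex → ℕ := fun F K =>
    Nat.card {φ : F.rep.graph →g B ⊕g (⊤ : SimpleGraph F₀.1.rep.Vertex) //
      SimpleGraph.homTrace φ = K}
  let T : LabeledGraphClass → ℝ := fun F => Nat.card (F.rep.Vertex → A ⊕ F₀.1.rep.Vertex)
  have hT : ∀ F, T F ≠ 0 := fun F => Nat.cast_ne_zero.2 Nat.card_pos.ne'
  -- The sum over `K' ≤ K` of these trace-sorted terms is the density of `f` in `B ⊕g K`. The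
  -- normalization `T F` is the same for all `K`, so the inversion applies; its conclusion is used
  -- at trace `F₀`.
  have h := eq_zero_of_sum_le_eq_zero
    (fun K => ∑ F ∈ f.coeff.support, f.coeff F * (N F K / T F)) (fun K => by
      rw [Finset.sum_comm, ← hf K, density_eq_sum]
      refine Finset.sum_congr rfl fun F _ => ?_
      rw [← Finset.mul_sum, ← Finset.sum_div, PartiallyLabeledGraph.homDensity,
        SimpleGraph.card_hom_sum_eq, Nat.cast_sum]) F₀.1.rep.graph
  have hN : N F₀ F₀.1.rep.graph ≠ 0 := by
    have : Finite (F₀.1.rep.graph →g B ⊕g (⊤ : SimpleGraph F₀.1.rep.Vertex)) := DFunLike.finite _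
    -- The identity of `F₀` placed on the second summand has trace `F₀`.
    let φ : F₀.1.rep.graph →g B ⊕g (⊤ : SimpleGraph F₀.1.rep.Vertex) :=
      SimpleGraph.Embedding.sumInr.toHom.comp (SimpleGraph.Hom.ofLE le_top)
    have hφ : SimpleGraph.homTrace φ = F₀.1.rep.graph := by
      ext v w
      constructor
      · rintro ⟨-, x, y, hxy, hx, hy⟩
        rwa [← Sum.inr_injective hx, ← Sum.inr_injective hy]
      · exact fun hvw => ⟨Sum.inr_injective.ne hvw.ne, v, w, hvw, rfl, rfl⟩
    have : Nonempty {φ : F₀.1.rep.graph →g B ⊕g (⊤ : SimpleGraph F₀.1.rep.Vertex) //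
      SimpleGraph.homTrace φ = F₀.1.rep.graph} := ⟨⟨φ, hφ⟩⟩
    exact Nat.card_pos.ne'
  by_contra hc
  rw [Finset.sum_eq_single_of_mem F₀ (Finsupp.mem_support_iff.2 hc)] at h
  · exact mul_ne_zero hc (div_ne_zero (Nat.cast_ne_zero.2 hN) (hT F₀)) h
  -- Any other graph in the support with a map of trace `F₀` would be isomorphic to `F₀`.
  · intro F hF hne
    have : IsEmpty {φ : F.1.rep.graph →g B ⊕g (⊤ : SimpleGraph F₀.1.rep.Vertex) //
        SimpleGraph.homTrace φ = F₀.1.rep.graph} := by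
      refine ⟨fun ⟨φ, hφ⟩ => hne ?_⟩
      obtain ⟨e⟩ := SimpleGraph.nonempty_iso_of_homTrace φ (by rw [hφ]; exact hF₀) (hmax F hF)
      rw [hφ] at e
      apply Subtype.ext
      rw [← mk_rep F.1, ← mk_rep F₀.1]
      exact (sound (PartiallyLabeledGraph.isIso_of_labels_eq_empty (rep_labels F₀)
        (rep_labels F) e)).symm
    rw [show N F F₀.1.rep.graph = 0 from Nat.card_of_isEmpty, Nat.cast_zero, zero_div, mul_zero]

end QuantumGraph

/-! ### The lemma on positive multiples -/

theorem mainTheorem5 (x g h : QuantumGraphAlgebra) (hg : g.IsPositive) (hh : h.IsPositive)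
    (hg0 : g ≠ 0) (hgx : g * x = h) : x.IsPositive := by
  intro W _ _ G
  by_contra hneg
  rw [not_le] at hneg
  obtain ⟨x, rfl⟩ := Ideal.Quotient.mk_surjective x
  obtain ⟨g, rfl⟩ := Ideal.Quotient.mk_surjective g
  obtain ⟨f, hf, hgf⟩ := g.exists_noIsolated_sub_mem
  rw [Ideal.Quotient.eq.2 hgf] at hg hg0 hgx
  have hf0 : f.coeff.support.Nonempty := by
    rw [Finsupp.support_nonempty_iff]
    intro h0
    have : f = 0 := MonoidAlgebra.coeff_injective h0
    exact hg0 (by rw [this, map_zero])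
  obtain ⟨F₀, hF₀, hmax⟩ := f.coeff.support.exists_max_image
    (fun F => Nat.card F.1.rep.Vertex) hf0
  have hev : ∀ K : SimpleGraph F₀.1.rep.Vertex, ∀ᶠ n : ℕ in atTop,
      QuantumGraph.density (G.comap (Prod.fst : W × Fin (n + 1) → W) ⊕g K) f = 0 := by
    intro K
    filter_upwards [(QuantumGraph.tendsto_density_blowUp_sum G K x).eventually_lt_const hneg]
      with n hn
    have h1 : 0 ≤ QuantumGraph.density (G.comap (Prod.fst : W × Fin (n + 1) → W) ⊕g K) f :=
      hg _ _
    have h2 : 0 ≤ QuantumGraph.density (G.comap (Prod.fst : W × Fin (n + 1) → W) ⊕g K) (f * x) := by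
      rw [← map_mul] at hgx
      have := hh _ (G.comap (Prod.fst : W × Fin (n + 1) → W) ⊕g K)
      rwa [← hgx] at this
    rw [map_mul] at h2
    -- The density of `x` is negative here and its product with that of `f` is nonnegative, so the
    -- density of `f` is at most zero.
    exact le_antisymm (nonpos_of_mul_nonneg_left h2 hn) h1
  -- Finitely many graphs on the vertices of `F₀` allow one `n` for all `K`; the inversion needs the
  -- same `B` throughout.
  obtain ⟨n, hn⟩ := (eventually_all.2 hev).exists
  exact Finsupp.mem_support_iff.1 hF₀
    (QuantumGraph.coeff_eq_zero_of_density_sum_eq_zero _ f F₀ (hf F₀ hF₀) hmax hn)
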